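/- Theorem. Let $X$ be a real separable Banach space which is quasireflexive, i.e. the canonical image of $X$ in its second dual $X^{**}$ has finite codimension. Let $m\ge 2$, and let $A_{pi}$, $1\le p\le m$, $1\le i\le n$, be continuous linear operators on $X$ with $\operatorname{Ker} A_{pi}=\{0\}$. Put $$G_i=\{(A_{1i}x,\dots,A_{mi}x)\in X^m : x\in X\},\qquad 1\le i\le n,$$ and suppose that $\overline{G_i}\cap\overline{G_j}=\{0\}$ for all $i\ne j$. Let $\xi_1,\dots,\xi_n$ be independent random variables with values in $X$ whose characteristic functionals $\widehat\mu_i(f)=\mathbf{E}\,e^{\mathrm{i} f(\xi_i)}$, $f\in X^*$, vanish nowhere on $X^*$. Put $L_p=A_{p1}\xi_1+\dots+A_{pn}\xi_n$, $1\le p\le m$, and suppose that the distribution of $\mathbf{L}=(L_1,\dots,L_m)$ belongs to the class $\mathcal{D}_{m,m-1}$, i.e. that its characteristic functional factorizes as $$\mathbf{E}\,e^{\mathrm{i}(f_1(L_1)+\dots+f_m(L_m))}=\prod_{1\le i_1<\dots<i_{m-1}\le m}R_{i_1,\dots,i_{m-1}}(f_{i_1},\dots,f_{i_{m-1}}),\qquad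 f_1,\dots,f_m\in X^*,$$ where the functions $R_{i_1,\dots,i_{m-1}}:(X^*)^{m-1}\to\mathbb{C}$ are continuous in the norm topology and $R_{i_1,\dots,i_{m-1}}(0,\dots,0)=1$. Then every $\xi_i$ is Gaussian, i.e. for every $f\in X^*$ the real random variable $f(\xi_i)$ is Gaussian (possibly degenerate). -/

import Mathlib

open MeasureTheory ProbabilityTheory
open scoped BigOperators

/-- A real normed space `X` is quasireflexive if the canonical image of `X` in its second dual
has finite codimension. -/
def IsQuasireflexive (X : Type*) [NormedAddCommGroup X] [NormedSpace ℝ X] : Prop :=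
  FiniteDimensional ℝ
    (StrongDual ℝ (StrongDual ℝ X) ⧸
      LinearMap.range
        (NormedSpace.inclusionInDoubleDual ℝ X : X →ₗ[ℝ] StrongDual ℝ (StrongDual ℝ X)))

/-- The continuous linear functional `x ↦ f₁(x₁) + ⋯ + fₘ(xₘ)` on `Xᵐ`. -/
noncomputable def tupleDual {X : Type*} [NormedAddCommGroup X] [NormedSpace ℝ X] {m : ℕ}
    (f : Fin m → StrongDual ℝ X) : StrongDual ℝ (Fin m → X) :=
  ∑ p, (f p).comp (ContinuousLinearMap.proj p)

/-- Kagan's class `D_{m,k}` (for `1 ≤ k ≤ m`) of distributions `ν` on `Xᵐ`: the characteristic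
functional of `ν` is a product of functions `R_S`, one for every set `S = {i₁ < ⋯ < iₖ}` of `k`
indices, where `R_S` is a continuous complex function of the variables `(f_i)_{i ∈ S}` only, with
`R_S(0) = 1`. -/
def KaganClass {X : Type*} [NormedAddCommGroup X] [NormedSpace ℝ X] [MeasurableSpace X]
    (m k : ℕ) (ν : Measure (Fin m → X)) : Prop :=
  ∃ R : (S : Finset (Fin m)) → (S → StrongDual ℝ X) → ℂ,
    (∀ S, S.card = k → Continuous (R S) ∧ R S 0 = 1) ∧
    ∀ f : Fin m → StrongDual ℝ X,
      charFunDual ν (tupleDual f) =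
        ∏ S ∈ Finset.powersetCard k Finset.univ, R S (fun i => f i)

/-- The set `G_i = {(A_{1i} x, …, A_{mi} x) : x ∈ X}` for the `i`-th column of operators. -/
def columnRange {X : Type*} [NormedAddCommGroup X] [NormedSpace ℝ X] {m n : ℕ}
    (A : Fin m → Fin n → X →L[ℝ] X) (i : Fin n) : Set (Fin m → X) :=
  Set.range (fun (x : X) (p : Fin m) => A p i x)

/-! By independence the hypothesis reads `∏ i, μ̂ᵢ(Aᵢ* f) = ∏ S, R_S(f_S)`, where `Aᵢ*` is the
adjoint of the `i`-th column. All factors are nonzero, so this is an additive equation in `Additive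
ℂˣ`, and no logarithm on `X*` is needed.

A difference with step in the `p`-th coordinate kills every `R_S` with `p ∉ S`; one with step in
`ker Aⱼ*` kills the `j`-th column. Together they isolate `μ̂ᵢ`: its differences vanish for steps in
the images under `Aᵢ*` of these subspaces. Injectivity of the `A_{pi}` and `closure Gᵢ ∩ closure Gⱼ
= {0}` say that these images separate the points of `X` (`total_map_range_single`, `total_map_ker`).
In a separable quasireflexive space such subspaces are weak-* sequentially dense
(`isWeakStarSeqDense_of_total`). As `μ̂ᵢ` is weak-* sequentially continuous, all its differences of
some order are trivial.

On each line `μ̂ᵢ` is then the exponential of a polynomial, by Fréchet's theorem applied to a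
continuous logarithm, and Marcinkiewicz's theorem makes `f(ξᵢ)` Gaussian. -/

open Filter Topology

/-! ### Total subspaces of the dual of a quasireflexive space -/

section WeakStar

variable {X : Type*} [NormedAddCommGroup X] [NormedSpace ℝ X]

/-- A set of functionals is weak-* sequentially dense if every functional is the pointwise limit
of a sequence from it. -/
def IsWeakStarSeqDense (S : Set (StrongDual ℝ X)) : Prop :=
  ∀ f : StrongDual ℝ X, ∃ v : ℕ → StrongDual ℝ X, (∀ n, v n ∈ S) ∧
    ∀ x, Tendsto (fun n => v n x) atTop (𝓝 (f x))

/-- An injective bounded operator between Banach spaces with range of finite codimension is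
bounded below. -/
lemma exists_antilipschitzWith_of_finiteDimensional_quotient [CompleteSpace X]
    {F : Type*} [NormedAddCommGroup F] [NormedSpace ℝ F] [CompleteSpace F] (ρ : X →L[ℝ] F)
    (hker : LinearMap.ker (ρ : X →ₗ[ℝ] F) = ⊥)
    (hfin : FiniteDimensional ℝ (F ⧸ LinearMap.range (ρ : X →ₗ[ℝ] F))) :
    ∃ K, AntilipschitzWith K ρ := by
  obtain ⟨G, hG⟩ := Submodule.exists_isCompl (LinearMap.range (ρ : X →ₗ[ℝ] F))
  have : FiniteDimensional ℝ G :=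
    Module.Finite.equiv (Submodule.quotientEquivOfIsCompl _ _ hG)
  exact ρ.antilipschitz_of_injective_of_isClosed_range (LinearMap.ker_eq_bot.1 hker)
    (ContinuousLinearMap.closed_complemented_range_of_isCompl_of_ker_eq_bot
      ρ G hG (Submodule.closed_of_finiteDimensional G) hker)

lemma finiteDimensional_quotient_range_comp {M N N' : Type*} [AddCommGroup M] [Module ℝ M]
    [AddCommGroup N] [Module ℝ N] [AddCommGroup N'] [Module ℝ N'] (J : M →ₗ[ℝ] N)
    (r : N →ₗ[ℝ] N') (hr : Function.Surjective r)
    (hJ : FiniteDimensional ℝ (N ⧸ LinearMap.range J)) :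
    FiniteDimensional ℝ (N' ⧸ LinearMap.range (r.comp J)) := by
  have hle : LinearMap.range J ≤ (LinearMap.range (r.comp J)).comap r := by
    rintro _ ⟨x, rfl⟩
    exact ⟨x, rfl⟩
  refine Module.Finite.of_surjective (Submodule.mapQ _ _ r hle) ?_
  intro y
  obtain ⟨y, rfl⟩ := Submodule.mkQ_surjective _ y
  obtain ⟨g, rfl⟩ := hr y
  exact ⟨Submodule.mkQ _ g, by simp⟩

lemma exists_norm_le_of_restriction [CompleteSpace X]
    {E W : Type*} [NormedAddCommGroup E] [NormedSpace ℝ E] [NormedAddCommGroup W] [NormedSpace ℝ W]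
    (J : X →L[ℝ] StrongDual ℝ E)
    (hJ : FiniteDimensional ℝ
      (StrongDual ℝ E ⧸ LinearMap.range (J : X →ₗ[ℝ] StrongDual ℝ E)))
    (r : StrongDual ℝ E →L[ℝ] StrongDual ℝ W) (hr : Function.Surjective r)
    (hinj : ∀ x, (∀ w, r (J x) w = 0) → x = 0) :
    ∃ C : ℝ, 0 ≤ C ∧ ∀ (x : X) (M : ℝ), (∀ w, ‖w‖ ≤ 1 → r (J x) w ≤ M) → ‖x‖ ≤ C * M := by
  have hker : LinearMap.ker ((r.comp J : X →L[ℝ] StrongDual ℝ W) : X →ₗ[ℝ] StrongDual ℝ W) = ⊥ :=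
    (Submodule.eq_bot_iff _).2 fun x hx => hinj x fun w => DFunLike.congr_fun hx w
  obtain ⟨K, hK⟩ := exists_antilipschitzWith_of_finiteDimensional_quotient (r.comp J) hker
    (finiteDimensional_quotient_range_comp J.toLinearMap r.toLinearMap hr hJ)
  refine ⟨K, K.2, fun x M hM => ?_⟩
  have h1 : ‖x‖ ≤ K * ‖r (J x)‖ := by
    simpa using hK.le_mul_dist x 0
  refine h1.trans (mul_le_mul_of_nonneg_left ?_ K.2)
  have hM0 : 0 ≤ M := by simpa using hM 0 (by simp)
  refine ContinuousLinearMap.opNorm_le_of_unit_norm hM0 fun w hw => ?_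
  have h2 := hM w hw.le
  have h3 := hM (-w) (by simp [hw])
  rw [map_neg] at h3
  exact abs_le.2 ⟨by linarith, h2⟩

lemma exists_norm_le_of_finiteDimensional_quotient [CompleteSpace X]
    {E : Type*} [NormedAddCommGroup E] [NormedSpace ℝ E] (J : X →L[ℝ] StrongDual ℝ E)
    (hJ : FiniteDimensional ℝ
      (StrongDual ℝ E ⧸ LinearMap.range (J : X →ₗ[ℝ] StrongDual ℝ E)))
    (V : Submodule ℝ E) (hV : ∀ x, (∀ v ∈ V, J x v = 0) → x = 0) :
    ∃ C : ℝ, 0 ≤ C ∧ ∀ (x : X) (M : ℝ), (∀ v ∈ V, ‖v‖ ≤ 1 → J x v ≤ M) → ‖x‖ ≤ C * M := by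
  have hsurj : Function.Surjective ((ContinuousLinearMap.compL ℝ V E ℝ).flip V.subtypeL) :=
    fun y => by
      obtain ⟨g, hg, -⟩ := exists_extension_norm_eq V y
      exact ⟨g, ContinuousLinearMap.ext hg⟩
  obtain ⟨C, hC0, hC⟩ := exists_norm_le_of_restriction J hJ
    ((ContinuousLinearMap.compL ℝ V E ℝ).flip V.subtypeL) hsurj
    (fun x hx => hV x fun v hv => hx ⟨v, hv⟩)
  exact ⟨C, hC0, fun x M hM => hC x M fun w hw => hM w w.2 hw⟩

/-- Quasireflexivity enters here: restriction `X** → V*` is onto by Hahn–Banach, so `X → V*` is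
injective with range of finite codimension, hence bounded below. Thus a total subspace is norming.
-/
lemma exists_norm_le_of_total [CompleteSpace X] (hX : IsQuasireflexive X)
    (V : Submodule ℝ (StrongDual ℝ X)) (hV : ∀ x, (∀ v ∈ V, v x = 0) → x = 0) :
    ∃ C : ℝ, 0 ≤ C ∧ ∀ (x : X) (M : ℝ), (∀ v ∈ V, ‖v‖ ≤ 1 → v x ≤ M) → ‖x‖ ≤ C * M :=
  exists_norm_le_of_finiteDimensional_quotient (NormedSpace.inclusionInDoubleDual ℝ X) hX V hV

/-- Helly's theorem: approximate interpolation at finitely many points with norm control. -/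
lemma exists_mem_norm_le_approx {V : Submodule ℝ (StrongDual ℝ X)} {C : ℝ} (hC0 : 0 ≤ C)
    (hC : ∀ (x : X) (M : ℝ), (∀ v ∈ V, ‖v‖ ≤ 1 → v x ≤ M) → ‖x‖ ≤ C * M)
    (f : StrongDual ℝ X) {ι : Type*} [Fintype ι] (x : ι → X) {ε : ℝ} (hε : 0 < ε) :
    ∃ v ∈ V, ‖v‖ ≤ C * ‖f‖ + 1 ∧ ∀ i, |v (x i) - f (x i)| < ε := by
  classical
  -- The summand 1 only keeps the radius positive.
  set R := C * ‖f‖ + 1 with hRdef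
  have hR : 0 < R := by positivity
  let T : StrongDual ℝ X →ₗ[ℝ] (ι → ℝ) :=
    { toFun := fun v i => v (x i)
      map_add' := fun _ _ => rfl
      map_smul' := fun _ _ => rfl }
  let B : Set (StrongDual ℝ X) := V ∩ Metric.closedBall 0 R
  have hB : Convex ℝ B := V.convex.inter (convex_closedBall _ _)
  by_cases hmem : T f ∈ closure (T '' B)
  · obtain ⟨_, ⟨v, ⟨hvV, hvR⟩, rfl⟩, hv⟩ := Metric.mem_closure_iff.1 hmem ε hε
    refine ⟨v, hvV, by simpa using hvR, fun i => ?_⟩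
    rw [dist_comm] at hv
    exact (dist_le_pi_dist _ _ i).trans_lt hv
  exfalso
  obtain ⟨φ, u, hu, huf⟩ := geometric_hahn_banach_closed_point
    (hB.linear_image T).closure isClosed_closure hmem
  -- The separating functional on `ι → ℝ` is evaluation at a vector `y` of `X`; the norming
  -- inequality at `y` contradicts the separation.
  set y := ∑ i, φ (Pi.single i 1) • x i with hy
  have hφ : ∀ v : StrongDual ℝ X, φ (T v) = v y := by
    intro v
    have : T v = ∑ i, v (x i) • (Pi.single i 1 : ι → ℝ) := by
      ext j
      simp [T, Pi.single_apply]
    rw [this, map_sum, hy, map_sum]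
    simp only [map_smul, smul_eq_mul, mul_comm]
  have hlt : ∀ v ∈ V, ‖v‖ ≤ R → v y < u := fun v hv hvR => by
    rw [← hφ]
    exact hu _ (subset_closure ⟨v, ⟨hv, by simpa using hvR⟩, rfl⟩)
  have hu0 : 0 < u := by simpa using hlt 0 V.zero_mem (by simpa using hR.le)
  have hyn : ‖y‖ ≤ C * (u / R) := by
    refine hC y _ fun v hv hv1 => ?_
    have := hlt (R • v) (V.smul_mem _ hv) (by
      rw [norm_smul, Real.norm_of_nonneg hR.le]; nlinarith)
    rw [le_div_iff₀ hR]
    simp only [smul_apply, smul_eq_mul] at this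
    linarith
  rw [hφ] at huf
  have h1 : f y ≤ ‖f‖ * (C * (u / R)) :=
    (le_abs_self _).trans ((f.le_opNorm y).trans (by gcongr))
  have h2 : ‖f‖ * (C * (u / R)) = (C * ‖f‖) * u / R := by ring
  have h3 : (C * ‖f‖) * u / R ≤ u := by
    rw [div_le_iff₀ hR, hRdef]; nlinarith
  linarith

/-- Helly's theorem at the first `n + 1` points of a dense sequence gives norm-bounded approximants;
boundedness carries convergence from the dense set to all of `X`. -/
theorem isWeakStarSeqDense_of_total [CompleteSpace X] [TopologicalSpace.SeparableSpace X]
    (hX : IsQuasireflexive X)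
    (V : Submodule ℝ (StrongDual ℝ X)) (hV : ∀ x, (∀ v ∈ V, v x = 0) → x = 0) :
    IsWeakStarSeqDense (V : Set (StrongDual ℝ X)) := by
  intro f
  obtain ⟨C, hC0, hC⟩ := exists_norm_le_of_total hX V hV
  let d := TopologicalSpace.denseSeq X
  choose v hvV hvR hv using fun n : ℕ => exists_mem_norm_le_approx hC0 hC f
    (fun i : Fin (n + 1) => d i) (ε := 1 / (n + 1)) (by positivity)
  refine ⟨v, hvV, fun x => ?_⟩
  rw [Metric.tendsto_atTop]
  intro ε hε
  set R := C * ‖f‖ + 1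
  have hR : 0 < R := by positivity
  obtain ⟨k, hk⟩ := (TopologicalSpace.denseRange_denseSeq X).exists_dist_lt x
    (ε := ε / (3 * (R + ‖f‖))) (by positivity)
  obtain ⟨N, hN⟩ := exists_nat_one_div_lt (show 0 < ε / 3 by positivity)
  refine ⟨max k N, fun n hn => ?_⟩
  have hkn : k < n + 1 := by have := le_max_left k N; omega
  have hNn : N ≤ n := (le_max_right k N).trans hn
  have h1 := hv n ⟨k, hkn⟩
  have h2 : (1 : ℝ) / (n + 1) ≤ 1 / (N + 1) := by gcongr
  have h3 : ‖x - d k‖ * (R + ‖f‖) < ε / 3 := by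
    rw [dist_eq_norm, lt_div_iff₀ (by positivity)] at hk
    have : ‖x - TopologicalSpace.denseSeq X k‖ = ‖x - d k‖ := rfl
    rw [this] at hk
    linarith
  have h4 : |v n (x - d k)| ≤ R * ‖x - d k‖ :=
    ((v n).le_opNorm _).trans (by gcongr; exact hvR n)
  have h5 : |f (x - d k)| ≤ ‖f‖ * ‖x - d k‖ := f.le_opNorm _
  rw [Real.dist_eq]
  simp only [map_sub] at h4 h5
  simp only at h1
  rw [abs_lt] at *
  rw [abs_le] at *
  constructor <;> nlinarith

end WeakStar

/-! ### Iterated differences -/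

section Differences

variable {E F G : Type*} [AddCommGroup E] [AddCommGroup F] [AddCommGroup G]

/-- The iterated difference of `φ` with the list of steps `L`. -/
def diffList (L : List E) (φ : E → G) : E → G := L.foldr fwdDiff φ

@[simp] lemma diffList_nil (φ : E → G) : diffList [] φ = φ := rfl

@[simp] lemma diffList_cons (h : E) (L : List E) (φ : E → G) :
    diffList (h :: L) φ = fwdDiff h (diffList L φ) := rfl

lemma fwdDiff_fwdDiff_comm (h k : E) (φ : E → G) :
    fwdDiff h (fwdDiff k φ) = fwdDiff k (fwdDiff h φ) := by
  ext u
  simp only [fwdDiff, add_right_comm u h k]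
  abel

lemma fwdDiff_diffList_comm (h : E) (L : List E) (φ : E → G) :
    fwdDiff h (diffList L φ) = diffList L (fwdDiff h φ) := by
  induction L with
  | nil => rfl
  | cons k L ih => rw [diffList_cons, diffList_cons, fwdDiff_fwdDiff_comm, ih]

lemma diffList_zero (L : List E) : diffList L (0 : E → G) = 0 := by
  induction L with
  | nil => rfl
  | cons k L ih => rw [diffList_cons, ih]; ext; simp [fwdDiff]

/-- Differences commute, so one annihilating step suffices wherever it stands in the list. -/
lemma diffList_eq_zero_of_mem {h : E} {L : List E} (hL : h ∈ L) {φ : E → G}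
    (hφ : fwdDiff h φ = 0) : diffList L φ = 0 := by
  induction L with
  | nil => simp at hL
  | cons k L ih =>
    rw [diffList_cons]
    rcases List.mem_cons.1 hL with rfl | hL
    · rw [fwdDiff_diffList_comm, hφ, diffList_zero]
    · rw [ih hL]; ext; simp [fwdDiff]

lemma diffList_finsetSum {α : Type*} (s : Finset α) (L : List E) (φ : α → E → G) :
    diffList L (∑ a ∈ s, φ a) = ∑ a ∈ s, diffList L (φ a) := by
  induction L with
  | nil => rfl
  | cons k L ih => simp only [diffList_cons, ih, fwdDiff_finsetSum]

lemma diffList_comp (T : F →+ E) (L : List F) (φ : E → G) :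
    diffList L (φ ∘ T) = diffList (L.map T) φ ∘ T := by
  induction L with
  | nil => rfl
  | cons k L ih => ext u; simp [ih, fwdDiff]

lemma diffList_replicate (h : E) (N : ℕ) (φ : E → G) :
    diffList (List.replicate N h) φ = (fwdDiff h)^[N] φ := by
  induction N with
  | zero => rfl
  | succ N ih => rw [List.replicate_succ, diffList_cons, ih, Function.iterate_succ_apply']

end Differences

/-! ### Extending vanishing differences from dense sets of steps -/

section SequentialExtension

variable {X : Type*} [NormedAddCommGroup X] [NormedSpace ℝ X]
  {G : Type*} [AddCommGroup G] [TopologicalSpace G]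

/-- Sequential weak-* continuity of a map on the dual. -/
def IsWeakStarSeqContinuous (φ : StrongDual ℝ X → G) : Prop :=
  ∀ (v : ℕ → StrongDual ℝ X) (f : StrongDual ℝ X), (∀ x, Tendsto (fun n => v n x) atTop (𝓝 (f x))) →
    Tendsto (fun n => φ (v n)) atTop (𝓝 (φ f))

lemma IsWeakStarSeqContinuous.eq_zero_of_dense [T2Space G] {φ : StrongDual ℝ X → G}
    (hφ : IsWeakStarSeqContinuous φ) {S : Set (StrongDual ℝ X)} (hS : IsWeakStarSeqDense S)
    (h0 : ∀ u ∈ S, φ u = 0) (u : StrongDual ℝ X) : φ u = 0 := by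
  obtain ⟨v, hvS, hv⟩ := hS u
  have h1 := hφ v u hv
  simp only [h0 _ (hvS _)] at h1
  exact tendsto_nhds_unique h1 tendsto_const_nhds

variable [IsTopologicalAddGroup G]

lemma IsWeakStarSeqContinuous.fwdDiff {φ : StrongDual ℝ X → G} (hφ : IsWeakStarSeqContinuous φ)
    (h : StrongDual ℝ X) : IsWeakStarSeqContinuous (fwdDiff h φ) := by
  intro v f hv
  exact (hφ (fun n => v n + h) (f + h) fun x => (hv x).add_const _).sub (hφ v f hv)

lemma IsWeakStarSeqContinuous.diffList {φ : StrongDual ℝ X → G} (hφ : IsWeakStarSeqContinuous φ)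
    (L : List (StrongDual ℝ X)) : IsWeakStarSeqContinuous (diffList L φ) := by
  induction L with
  | nil => exact hφ
  | cons h L ih => exact ih.fwdDiff h

/-- If the iterated differences with steps from weak-* sequentially dense sets vanish, then all
iterated differences of that order vanish. -/
theorem diffList_eq_zero_of_dense [T2Space G] (Vs : List (Set (StrongDual ℝ X)))
    (hVs : ∀ S ∈ Vs, IsWeakStarSeqDense S) {φ : StrongDual ℝ X → G}
    (hφ : IsWeakStarSeqContinuous φ)
    (h0 : ∀ L, List.Forall₂ (· ∈ ·) L Vs → ∀ u, diffList L φ u = 0)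
    (L : List (StrongDual ℝ X)) (hL : L.length = Vs.length) (u : StrongDual ℝ X) :
    diffList L φ u = 0 := by
  induction Vs generalizing φ L u with
  | nil =>
    obtain rfl : L = [] := List.length_eq_zero_iff.1 hL
    exact h0 [] .nil u
  | cons S Vs ih =>
    obtain _ | ⟨h, L⟩ := L
    · simp at hL
    have hL' : L.length = Vs.length := by simpa using hL
    -- Induction applied to `fwdDiff k φ` frees the remaining steps; for these fixed, the difference
    -- is sequentially continuous in `k`, so `k` is freed as well.
    have key : ∀ k ∈ S, fwdDiff k (diffList L φ) u = 0 := fun k hk => by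
      rw [fwdDiff_diffList_comm]
      refine ih (fun S' hS' => hVs S' (List.mem_cons_of_mem _ hS')) (hφ.fwdDiff k)
        (fun L' hL' u' => ?_) L hL' u
      rw [← fwdDiff_diffList_comm]
      exact h0 (k :: L') (.cons hk hL') u'
    have hc : IsWeakStarSeqContinuous (fun k => fwdDiff k (diffList L φ) u) := fun v f hv =>
      ((hφ.diffList L) (fun n => u + v n) (u + f) fun x => (hv x).const_add _).sub_const _
    exact hc.eq_zero_of_dense (hVs S List.mem_cons_self) key h

end SequentialExtension

/-! ### Fréchet's theorem and continuous logarithms -/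

section Frechet

lemma fwdDiff_iterate_eq_zero_of_le {E G : Type*} [AddCommGroup E] [AddCommGroup G] {h : E}
    {φ : E → G} {N k : ℕ} (hN : ∀ t, (fwdDiff h)^[N] φ t = 0) (hk : N ≤ k) (t : E) :
    (fwdDiff h)^[k] φ t = 0 := by
  obtain ⟨j, rfl⟩ := Nat.exists_eq_add_of_le' hk
  induction j generalizing t with
  | zero => simpa using hN t
  | succ j ih =>
    have h1 : j + 1 + N = (j + N) + 1 := by ring
    rw [h1, Function.iterate_succ_apply', fwdDiff]
    have h2 := fun t => ih t (Nat.le_add_left N j)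
    simp only [h2, sub_zero]

/-- Newton's forward difference formula stops at order `N`, and its binomial coefficients are
polynomials in `n`. -/
lemma exists_polynomial_eval_nat {φ : ℝ → ℂ} {N : ℕ} {h : ℝ}
    (hN : ∀ t, (fwdDiff h)^[N] φ t = 0) (y : ℝ) :
    ∃ q : Polynomial ℂ, ∀ n : ℕ, φ (y + n * h) = q.eval (n : ℂ) := by
  refine ⟨∑ k ∈ Finset.range N,
    Polynomial.C ((fwdDiff h)^[k] φ y / (k.factorial : ℂ)) * descPochhammer ℂ k, fun n => ?_⟩
  rw [← nsmul_eq_mul, shift_eq_sum_fwdDiff_iter h φ n y, Polynomial.eval_finsetSum]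
  have h1 : ∀ m, n + 1 ≤ m → ∑ k ∈ Finset.range (n + 1), n.choose k • (fwdDiff h)^[k] φ y =
      ∑ k ∈ Finset.range m, n.choose k • (fwdDiff h)^[k] φ y := fun m hm =>
    Finset.sum_subset (Finset.range_subset_range.2 hm) fun k _ hk => by
      rw [Nat.choose_eq_zero_of_lt (by simpa using hk), zero_smul]
  have h2 : ∀ m, N ≤ m → ∑ k ∈ Finset.range N, n.choose k • (fwdDiff h)^[k] φ y =
      ∑ k ∈ Finset.range m, n.choose k • (fwdDiff h)^[k] φ y := fun m hm =>
    Finset.sum_subset (Finset.range_subset_range.2 hm) fun k _ hk => by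
      rw [fwdDiff_iterate_eq_zero_of_le hN (by simpa using hk), smul_zero]
  rw [h1 (max (n + 1) N) (le_max_left _ _), ← h2 _ (le_max_right _ _)]
  refine Finset.sum_congr rfl fun k _ => ?_
  rw [Polynomial.eval_mul, Polynomial.eval_C, nsmul_eq_mul, Nat.cast_choose_eq_descPochhammer_div]
  ring

/-- Fréchet: a continuous function all of whose differences of some order vanish is a polynomial. -/
theorem exists_polynomial_of_fwdDiff_iterate_eq_zero {φ : ℝ → ℂ} (hφ : Continuous φ) {N : ℕ}
    (hN : ∀ h t, (fwdDiff h)^[N] φ t = 0) :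
    ∃ p : Polynomial ℂ, ∀ t : ℝ, φ t = p.eval (t : ℂ) := by
  obtain ⟨p, hp⟩ := exists_polynomial_eval_nat (hN 1) 0
  simp only [mul_one, zero_add] at hp
  refine ⟨p, fun t => ?_⟩
  have hpc : Continuous fun t : ℝ => p.eval (t : ℂ) := by fun_prop
  refine congrFun (Rat.denseRange_cast.equalizer hφ hpc ?_) t
  ext r
  set M := r.num.natAbs with hM
  have hden : (r.den : ℝ) ≠ 0 := by exact_mod_cast r.den_nz
  have hdenC : (r.den : ℂ) ≠ 0 := by exact_mod_cast r.den_nz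
  -- The grid of mesh `1 / r.den` starting at `-M` contains `r` and all natural numbers, so its
  -- polynomial is forced to agree with `p` after rescaling.
  obtain ⟨q, hq⟩ := exists_polynomial_eval_nat (hN (1 / r.den)) (-M : ℝ)
  have hQ : q.comp (Polynomial.C (r.den : ℂ) * (Polynomial.X + Polynomial.C (M : ℂ))) = p := by
    refine Polynomial.eq_of_infinite_eval_eq _ _
      ((Set.infinite_range_of_injective (Nat.cast_injective (R := ℂ))).mono ?_)
    rintro _ ⟨a, rfl⟩
    have h1 := hq (r.den * (a + M))
    have h2 : (-M : ℝ) + ((r.den * (a + M) : ℕ) : ℝ) * (1 / r.den) = a := by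
      push_cast
      field_simp
      ring
    rw [h2, hp] at h1
    simp only [Set.mem_ofPred_eq, Polynomial.eval_comp, Polynomial.eval_mul, Polynomial.eval_C,
      Polynomial.eval_add, Polynomial.eval_X]
    rw [h1]
    push_cast
    rfl
  have hnn : 0 ≤ r.num + M * r.den := by
    have h1 : (1 : ℤ) ≤ r.den := by exact_mod_cast r.den_pos
    have h2 : -(M : ℤ) ≤ r.num := by rw [hM]; omega
    nlinarith [Int.natCast_nonneg M]
  obtain ⟨n, hn⟩ := Int.eq_ofNat_of_zero_le hnn
  have hrR : (r : ℝ) = -M + n * (1 / r.den) := by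
    have h1 : ((n : ℤ) : ℝ) = ((r.num + M * r.den : ℤ) : ℝ) := by rw [hn]
    push_cast at h1
    rw [h1, Rat.cast_def]
    field_simp
    ring
  have h3 := hq n
  rw [← hrR] at h3
  simp only [Function.comp_apply]
  rw [h3, ← hQ, Polynomial.eval_comp]
  congr 1
  have h4 : (((r : ℝ) : ℂ)) = ((-M + n * (1 / r.den) : ℝ) : ℂ) := by rw [hrR]
  simp only [Polynomial.eval_mul, Polynomial.eval_C, Polynomial.eval_add, Polynomial.eval_X]
  rw [h4]
  push_cast
  field_simp
  ring

/-- The path `g` lifts through the covering `exp : ℂ → ℂ \ {0}`. -/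
lemma exists_continuous_log {g : ℝ → ℂ} (hg : Continuous g) (h0 : g 0 = 1) (hne : ∀ t, g t ≠ 0) :
    ∃ φ : ℝ → ℂ, Continuous φ ∧ φ 0 = 0 ∧ ∀ t, Complex.exp (φ t) = g t := by
  obtain ⟨F, ⟨hF0, hF⟩, -⟩ := Complex.isCoveringMapOn_exp.existsUnique_continuousMap_lifts
    (⟨g, hg⟩ : C(ℝ, ℂ)) (a₀ := 0) (e₀ := 0) (by simp [h0]) (by simpa using hne)
  exact ⟨F, F.continuous, hF0, fun t => congrFun hF t⟩

lemma eq_zero_of_exp_eq_one {ψ : ℝ → ℂ} (hψ : Continuous ψ) (h0 : ψ 0 = 0)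
    (h1 : ∀ t, Complex.exp (ψ t) = 1) (t : ℝ) : ψ t = 0 := by
  obtain ⟨F, -, huniq⟩ := Complex.isCoveringMapOn_exp.existsUnique_continuousMap_lifts
    (ContinuousMap.const ℝ (1 : ℂ)) (a₀ := 0) (e₀ := 0) (by simp) (by simp)
  have e1 := huniq ⟨ψ, hψ⟩ ⟨h0, funext h1⟩
  have e2 := huniq (ContinuousMap.const ℝ 0) ⟨rfl, by ext; simp⟩
  exact DFunLike.congr_fun (e1.trans e2.symm) t

/-- The exponential as a homomorphism to the multiplicative group of `ℂ`, written additively. -/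
noncomputable def expUnits : ℂ →+ Additive ℂˣ where
  toFun z := Additive.ofMul (Units.mk0 (Complex.exp z) (Complex.exp_ne_zero z))
  map_zero' := by
    apply Additive.toMul.injective
    ext
    simp
  map_add' x y := by
    apply Additive.toMul.injective
    ext
    simp [Complex.exp_add]

lemma fwdDiff_iterate_hom_comp {E G H : Type*} [AddCommGroup E] [AddCommGroup G] [AddCommGroup H]
    (e : G →+ H) (h : E) (N : ℕ) (φ : E → G) :
    (fwdDiff h)^[N] (fun t => e (φ t)) = fun t => e ((fwdDiff h)^[N] φ t) := by
  induction N with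
  | zero => rfl
  | succ N ih => rw [Function.iterate_succ_apply', Function.iterate_succ_apply', ih]; ext; simp [fwdDiff]

/-- A nonvanishing continuous function whose multiplicative differences of some order are trivial
is the exponential of a polynomial. -/
theorem exists_eq_exp_polynomial {g : ℝ → ℂ} (hg : Continuous g) (h0 : g 0 = 1)
    (hne : ∀ t, g t ≠ 0) {N : ℕ} (hN0 : 0 < N)
    (hN : ∀ h t, (fwdDiff h)^[N] (fun s => Additive.ofMul (Units.mk0 (g s) (hne s))) t = 0) :
    ∃ p : Polynomial ℂ, p.eval 0 = 0 ∧ ∀ t : ℝ, g t = Complex.exp (p.eval (t : ℂ)) := by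
  obtain ⟨φ, hφ, hφ0, hexp⟩ := exists_continuous_log hg h0 hne
  have hΦ : (fun s => Additive.ofMul (Units.mk0 (g s) (hne s))) = fun s => expUnits (φ s) := by
    ext s
    simp [expUnits, hexp]
  have hone : ∀ h t, Complex.exp ((fwdDiff h)^[N] φ t) = 1 := fun h t => by
    have h1 := hN h t
    rw [hΦ, fwdDiff_iterate_hom_comp] at h1
    have h2 := congrArg (fun z : Additive ℂˣ => ((Additive.toMul z : ℂˣ) : ℂ)) h1
    simpa [expUnits] using h2
  -- As a function of the step `h`, the difference is continuous with exponential 1, and it vanishes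
  -- at `h = 0` because `N > 0`; uniqueness of lifts makes it zero.
  have hzero : ∀ h t, (fwdDiff h)^[N] φ t = 0 := fun h t => by
    refine eq_zero_of_exp_eq_one (ψ := fun h => (fwdDiff h)^[N] φ t) ?_ ?_ (fun h => hone h t) h
    · simp only [fwdDiff_iter_eq_sum_shift]
      fun_prop
    · obtain ⟨k, rfl⟩ := Nat.exists_eq_add_of_le' hN0
      simp [Function.iterate_succ_apply', fwdDiff]
  obtain ⟨p, hp⟩ := exists_polynomial_of_fwdDiff_iterate_eq_zero hφ hzero
  exact ⟨p, by simpa [hφ0] using (hp 0).symm, fun t => by rw [← hexp, hp]⟩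

end Frechet

/-! ### Marcinkiewicz's theorem -/

section Marcinkiewicz

lemma hasDerivAt_fwdDiff_iterate {G : ℂ → ℂ} (hG : Differentiable ℂ G) (h : ℂ) (n : ℕ) (z : ℂ) :
    HasDerivAt ((fwdDiff h)^[n] G) ((fwdDiff h)^[n] (deriv G) z) z := by
  induction n generalizing z with
  | zero => exact (hG z).hasDerivAt
  | succ n ih =>
    rw [Function.iterate_succ_apply', Function.iterate_succ_apply']
    exact ((ih (z + h)).comp_add_const z h).sub (ih z)

/-- Induction by the mean value inequality: the derivative of the `n`-th difference of `G` is the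
`n`-th difference of `deriv G`. -/
lemma norm_fwdDiff_iterate_le {G : ℂ → ℂ} (hG : Differentiable ℂ G) {B : ℝ} (n : ℕ)
    (hB : ∀ z, ‖z‖ ≤ 1 → ‖iteratedDeriv n G z‖ ≤ B) (h z : ℂ) (hz : ‖z‖ + n * ‖h‖ ≤ 1) :
    ‖(fwdDiff h)^[n] G z‖ ≤ B * ‖h‖ ^ n := by
  induction n generalizing G z with
  | zero => simpa using hB z (by simpa using hz)
  | succ n ih =>
    push_cast at hz
    have hbound : ∀ w ∈ Metric.closedBall (0 : ℂ) (‖z‖ + ‖h‖),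
        ‖(fwdDiff h)^[n] (deriv G) w‖ ≤ B * ‖h‖ ^ n := fun w hw => by
      have hw' : ‖w‖ ≤ ‖z‖ + ‖h‖ := by simpa using hw
      exact ih hG.deriv (fun z hz => by rw [← iteratedDeriv_succ']; exact hB z hz) w (by linarith)
    have h1 := (convex_closedBall (0 : ℂ) (‖z‖ + ‖h‖)).norm_image_sub_le_of_norm_hasDerivWithin_le
      (fun w _ => (hasDerivAt_fwdDiff_iterate hG h n w).hasDerivWithinAt) hbound
      (x := z) (y := z + h) (by simp) (by simpa using norm_add_le z h)
    rw [Function.iterate_succ_apply', fwdDiff]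
    refine h1.trans_eq ?_
    rw [add_sub_cancel_left]
    ring

lemma exists_norm_iteratedDeriv_le {G : ℂ → ℂ} (hG : Differentiable ℂ G) {R : ℝ} (hR : 0 < R) :
    ∃ C : ℝ, 0 ≤ C ∧ ∀ (n : ℕ) (z : ℂ), ‖z‖ ≤ 1 →
      ‖iteratedDeriv n G z‖ ≤ n.factorial * C / R ^ n := by
  obtain ⟨C, hC⟩ := (isCompact_closedBall (0 : ℂ) (1 + R)).exists_bound_of_continuousOn
    hG.continuous.continuousOn
  refine ⟨C, (norm_nonneg _).trans (hC 0 (by simp; positivity)), fun n z hz => ?_⟩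
  refine Complex.norm_iteratedDeriv_le_of_forall_mem_sphere_norm_le n hR hG.diffContOnCl
    fun w hw => hC w ?_
  have h1 : ‖w - z‖ = R := by simpa [dist_eq_norm] using hw
  have h2 : ‖w‖ ≤ ‖w - z‖ + ‖z‖ := by simpa using norm_add_le (w - z) z
  simp only [Metric.mem_closedBall, dist_zero_right]
  linarith

variable {μ : Measure ℝ} [IsProbabilityMeasure μ]

lemma fwdDiff_iterate_charFun (h : ℝ) (n : ℕ) (t : ℝ) :
    (fwdDiff h)^[n] (charFun μ) t =
      ∫ x, Complex.exp (t * x * Complex.I) * (Complex.exp (h * x * Complex.I) - 1) ^ n ∂μ := by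
  have hint : ∀ (n : ℕ) (t : ℝ), Integrable (fun x : ℝ => Complex.exp (t * x * Complex.I) *
      (Complex.exp (h * x * Complex.I) - 1) ^ n) μ := fun n t => by
    refine Integrable.of_bound (C := 2 ^ n) (by fun_prop) (ae_of_all _ fun x => ?_)
    have e1 : ∀ s : ℝ, ‖Complex.exp (s * x * Complex.I)‖ = 1 := fun s => by
      rw [← Complex.ofReal_mul, Complex.norm_exp_ofReal_mul_I]
    rw [norm_mul, norm_pow, e1, one_mul]
    gcongr
    refine (norm_sub_le _ _).trans ?_
    rw [e1]
    norm_num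
  induction n generalizing t with
  | zero => simp [charFun_apply_real]
  | succ n ih =>
    rw [Function.iterate_succ_apply', fwdDiff, ih, ih, ← integral_sub (hint n _) (hint n _)]
    congr 1
    ext x
    have : Complex.exp (((t + h : ℝ) : ℂ) * x * Complex.I) =
        Complex.exp (t * x * Complex.I) * Complex.exp (h * x * Complex.I) := by
      rw [← Complex.exp_add]
      push_cast
      ring_nf
    rw [this]
    ring

/-- Basing the difference of order `2k` at `-kh` centres it: the phases cancel and the integrand is
an even power of a sine, up to sign. -/
lemma exp_mul_exp_sub_one_pow (h x : ℝ) (k : ℕ) :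
    Complex.exp ((-(k * h) : ℝ) * x * Complex.I) * (Complex.exp (h * x * Complex.I) - 1) ^ (2 * k) =
      (((-1) ^ k * (2 * Real.sin (h * x / 2)) ^ (2 * k) : ℝ) : ℂ) := by
  have h1 : Complex.exp (h * x * Complex.I) - 1 =
      Complex.exp ((h * x / 2 : ℝ) * Complex.I) *
        (2 * Real.sin (h * x / 2) * Complex.I) := by
    have e1 : Complex.exp (h * x * Complex.I) =
        Complex.exp ((h * x / 2 : ℝ) * Complex.I) * Complex.exp ((h * x / 2 : ℝ) * Complex.I) := by
      rw [← Complex.exp_add]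
      push_cast
      ring_nf
    have e2 : (1 : ℂ) =
        Complex.exp ((h * x / 2 : ℝ) * Complex.I) * Complex.exp (-(h * x / 2 : ℝ) * Complex.I) := by
      rw [← Complex.exp_add]
      simp
    have e3 : (2 : ℂ) * Real.sin (h * x / 2) * Complex.I =
        Complex.exp ((h * x / 2 : ℝ) * Complex.I) - Complex.exp (-(h * x / 2 : ℝ) * Complex.I) := by
      rw [Complex.ofReal_sin, Complex.two_sin, mul_assoc, Complex.I_mul_I]
      ring
    rw [e3, mul_sub, ← e1, ← e2]
  have h2 : Complex.exp ((-(k * h) : ℝ) * x * Complex.I) *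
      Complex.exp ((h * x / 2 : ℝ) * Complex.I) ^ (2 * k) = 1 := by
    rw [← Complex.exp_nat_mul, ← Complex.exp_add, ← Complex.exp_zero]
    congr 1
    push_cast
    ring
  rw [h1, mul_pow, ← mul_assoc, h2, one_mul, mul_pow, pow_mul Complex.I, Complex.I_sq]
  push_cast
  ring

lemma integral_sin_pow_le {G : ℂ → ℂ} (hG : Differentiable ℂ G)
    (hμ : ∀ t : ℝ, charFun μ t = G t) {B : ℝ} (k : ℕ)
    (hB : ∀ z, ‖z‖ ≤ 1 → ‖iteratedDeriv (2 * k) G z‖ ≤ B) {h : ℝ} (h0 : 0 < h)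
    (hh : 3 * k * h ≤ 1) :
    ∫ x, (2 * Real.sin (h * x / 2) / h) ^ (2 * k) ∂μ ≤ B := by
  have e1 : ∀ n (t : ℝ), (fwdDiff h)^[n] (charFun μ) t = (fwdDiff (h : ℂ))^[n] G t := by
    intro n
    induction n with
    | zero => exact hμ
    | succ n ih =>
      intro t
      simp only [Function.iterate_succ_apply', fwdDiff, ih]
      push_cast
      rfl
  -- The base point contributes `kh` and the `2k` steps `2kh`, whence `3kh ≤ 1`.
  have e2 := norm_fwdDiff_iterate_le hG (2 * k) hB h ((-(k * h) : ℝ) : ℂ) (by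
    rw [Complex.norm_real, Complex.norm_real, Real.norm_of_nonneg h0.le, norm_neg,
      Real.norm_of_nonneg (by positivity)]
    push_cast
    linarith)
  rw [← e1, fwdDiff_iterate_charFun] at e2
  simp only [exp_mul_exp_sub_one_pow] at e2
  rw [integral_complex_ofReal, integral_const_mul, Complex.norm_real, norm_mul, norm_pow, norm_neg,
    norm_one, one_pow, one_mul, Complex.norm_real, Real.norm_of_nonneg h0.le] at e2
  simp only [div_pow]
  rw [integral_div, div_le_iff₀ (by positivity)]
  exact (le_abs_self _).trans e2

/-- Fatou's lemma as `h → 0`, since `2 sin(hx/2)/h → x`. -/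
lemma lintegral_pow_le {G : ℂ → ℂ} (hG : Differentiable ℂ G)
    (hμ : ∀ t : ℝ, charFun μ t = G t) {B : ℝ} (k : ℕ)
    (hB : ∀ z, ‖z‖ ≤ 1 → ‖iteratedDeriv (2 * k) G z‖ ≤ B) :
    ∫⁻ x, ENNReal.ofReal (x ^ (2 * k)) ∂μ ≤ ENNReal.ofReal B := by
  have hlim : Tendsto (fun j : ℕ => (1 : ℝ) / (j + 1)) atTop (𝓝 0) :=
    tendsto_one_div_add_atTop_nhds_zero_nat
  have hpt : ∀ x : ℝ, Tendsto (fun j : ℕ => ENNReal.ofReal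
      ((2 * Real.sin ((1 : ℝ) / (j + 1) * x / 2) / ((1 : ℝ) / (j + 1))) ^ (2 * k)))
      atTop (𝓝 (ENNReal.ofReal (x ^ (2 * k)))) := by
    intro x
    refine ENNReal.tendsto_ofReal (Tendsto.pow ?_ _)
    have hd : HasDerivAt (fun h : ℝ => 2 * Real.sin (h * x / 2)) x 0 := by
      have h1 : HasDerivAt (fun h : ℝ => h * x / 2) (1 * x / 2) 0 :=
        ((hasDerivAt_id (0 : ℝ)).mul_const x).div_const 2
      have h2 := (h1.sin).const_mul 2
      convert! h2 using 1
      simp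
      ring
    have h3 := (hasDerivAt_iff_tendsto_slope_zero.1 hd).comp
      (tendsto_nhdsWithin_iff.2 ⟨hlim, Eventually.of_forall fun j => by
        simp only [Set.mem_compl_iff, Set.mem_singleton_iff]; positivity⟩)
    refine h3.congr fun j => ?_
    simp [div_eq_inv_mul]
  calc ∫⁻ x, ENNReal.ofReal (x ^ (2 * k)) ∂μ
      = ∫⁻ x, liminf (fun j : ℕ => ENNReal.ofReal
        ((2 * Real.sin ((1 : ℝ) / (j + 1) * x / 2) / ((1 : ℝ) / (j + 1))) ^ (2 * k))) atTop ∂μ :=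
        lintegral_congr fun x => (hpt x).liminf_eq.symm
    _ ≤ liminf (fun j : ℕ => ∫⁻ x, ENNReal.ofReal
        ((2 * Real.sin ((1 : ℝ) / (j + 1) * x / 2) / ((1 : ℝ) / (j + 1))) ^ (2 * k)) ∂μ) atTop :=
        lintegral_liminf_le fun j => by fun_prop
    _ ≤ liminf (fun _ : ℕ => ENNReal.ofReal B) atTop := by
        refine liminf_le_liminf ?_
        have hev : ∀ᶠ j : ℕ in atTop, 3 * k * ((1 : ℝ) / (j + 1)) ≤ 1 := by
          have := hlim.const_mul (3 * k : ℝ)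
          rw [mul_zero] at this
          exact (this.eventually_lt_const one_pos).mono fun _ h => h.le
        filter_upwards [hev] with j hj
        rw [← ofReal_integral_eq_lintegral_ofReal]
        · exact ENNReal.ofReal_le_ofReal (integral_sin_pow_le hG hμ k hB (by positivity) hj)
        · refine Integrable.of_bound (C := (2 / ((1 : ℝ) / (j + 1))) ^ (2 * k)) (by fun_prop)
            (ae_of_all _ fun x => ?_)
          rw [norm_pow, norm_div, norm_mul]
          have h1 := Real.abs_sin_le_one ((1 : ℝ) / (j + 1) * x / 2)
          have h2 : (0 : ℝ) < 1 / (j + 1) := by positivity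
          rw [Real.norm_of_nonneg h2.le, Real.norm_of_nonneg (zero_le_two), Real.norm_eq_abs]
          gcongr
          linarith
        · exact ae_of_all _ fun x => by
            simp only [pow_mul]
            positivity
    _ = ENNReal.ofReal B := liminf_const _

/-- A distribution whose characteristic function extends to an entire function has all
exponential moments. -/
theorem integrable_exp_mul_of_charFun_entire {G : ℂ → ℂ} (hG : Differentiable ℂ G)
    (hμ : ∀ t : ℝ, charFun μ t = G t) (s : ℝ) : Integrable (fun x => Real.exp (s * x)) μ := by
  -- A Cauchy radius exceeding `|s|` makes the integrated series of `cosh (s x)` geometrically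
  -- convergent.
  obtain ⟨C, hC0, hC⟩ := exists_norm_iteratedDeriv_le hG (R := |s| + 1) (by positivity)
  have hterm : ∀ k : ℕ, ∫⁻ x, ENNReal.ofReal ((s * x) ^ (2 * k) / (2 * k).factorial) ∂μ ≤
      ENNReal.ofReal (C * ((|s| / (|s| + 1)) ^ 2) ^ k) := fun k => by
    have e1 : ∀ x : ℝ, ENNReal.ofReal ((s * x) ^ (2 * k) / (2 * k).factorial) =
        ENNReal.ofReal (s ^ (2 * k) / (2 * k).factorial) * ENNReal.ofReal (x ^ (2 * k)) := fun x => by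
      rw [← ENNReal.ofReal_mul (by rw [pow_mul]; positivity)]
      congr 1
      ring
    simp only [e1]
    rw [lintegral_const_mul _ (by fun_prop)]
    refine (mul_le_mul_right (lintegral_pow_le hG hμ k (hC (2 * k))) _).trans_eq ?_
    rw [← ENNReal.ofReal_mul (by rw [pow_mul]; positivity)]
    congr 1
    have h1 : ((2 * k).factorial : ℝ) ≠ 0 := by positivity
    rw [← pow_mul, div_pow, pow_mul |s|, sq_abs, ← pow_mul]
    field_simp
  have hlt : ∫⁻ x, ENNReal.ofReal (Real.cosh (s * x)) ∂μ < ⊤ := by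
    have e1 : ∀ x : ℝ, ENNReal.ofReal (Real.cosh (s * x)) =
        ∑' k : ℕ, ENNReal.ofReal ((s * x) ^ (2 * k) / (2 * k).factorial) := fun x => by
      rw [← ENNReal.ofReal_tsum_of_nonneg (fun k => by rw [pow_mul]; positivity)
        (Real.hasSum_cosh _).summable, (Real.hasSum_cosh _).tsum_eq]
    simp only [e1]
    rw [lintegral_tsum fun k => by fun_prop]
    have hq : (|s| / (|s| + 1)) ^ 2 < 1 := by
      rw [sq_lt_one_iff₀ (by positivity), div_lt_one (by positivity)]
      linarith
    have hsum : Summable fun k : ℕ => C * ((|s| / (|s| + 1)) ^ 2) ^ k :=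
      (summable_geometric_of_lt_one (by positivity) hq).mul_left C
    refine (ENNReal.tsum_le_tsum hterm).trans_lt ?_
    rw [← ENNReal.ofReal_tsum_of_nonneg (fun k => by positivity) hsum]
    exact ENNReal.ofReal_lt_top
  have hcosh : Integrable (fun x => Real.cosh (s * x)) μ := by
    refine ⟨by fun_prop, ?_⟩
    rw [hasFiniteIntegral_iff_ofReal (ae_of_all _ fun x => (Real.cosh_pos _).le)]
    exact hlt
  refine (hcosh.const_mul 2).mono' (by fun_prop) (ae_of_all _ fun x => ?_)
  rw [Real.norm_of_nonneg (Real.exp_pos _).le, Real.cosh_eq]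
  linarith [Real.exp_pos (-(s * x))]

/-- The ridge property of an entire characteristic function. -/
theorem norm_le_of_charFun_entire {G : ℂ → ℂ} (hG : Differentiable ℂ G)
    (hμ : ∀ t : ℝ, charFun μ t = G t) (w : ℂ) : ‖G w‖ ≤ ‖G (w.im * Complex.I)‖ := by
  have huniv : integrableExpSet id μ = Set.univ :=
    Set.eq_univ_of_forall fun s => integrable_exp_mul_of_charFun_entire hG hμ s
  have hdiff : Differentiable ℂ fun z => complexMGF id μ (z * Complex.I) := fun z =>
    DifferentiableAt.comp (g := complexMGF id μ) z
      (hasDerivAt_complexMGF (by simp [huniv])).differentiableAt (by fun_prop)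
  have hev : ∃ᶠ z : ℂ in 𝓝[≠] 0, complexMGF id μ (z * Complex.I) = G z := by
    have h1 : Tendsto (fun t : ℝ => (t : ℂ)) (𝓝[≠] 0) (𝓝[≠] 0) :=
      tendsto_nhdsWithin_iff.2 ⟨(Complex.continuous_ofReal.tendsto' 0 0 (by simp)).mono_left
        nhdsWithin_le_nhds, eventually_mem_nhdsWithin.mono fun t ht => by simpa using ht⟩
    refine h1.frequently (Eventually.frequently (Eventually.of_forall fun t => ?_))
    rw [complexMGF_id_mul_I, hμ]
  -- Both sides are entire and agree on the real axis.
  have heq : ∀ z, complexMGF id μ (z * Complex.I) = G z := fun z =>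
    (hdiff.differentiableOn.analyticOnNhd isOpen_univ).eqOn_of_preconnected_of_frequently_eq
      (hG.differentiableOn.analyticOnNhd isOpen_univ) isPreconnected_univ (Set.mem_univ 0) hev
      (Set.mem_univ z)
  have h1 : ‖G (w.im * Complex.I)‖ = mgf id μ (-w.im) := by
    rw [← heq, mul_assoc, Complex.I_mul_I, mul_neg_one, ← Complex.ofReal_neg, complexMGF_ofReal,
      Complex.norm_real, Real.norm_of_nonneg mgf_nonneg]
  rw [h1, ← heq]
  refine norm_complexMGF_le_mgf.trans_eq ?_
  simp

lemma tendsto_eval_mul_div_pow (p : Polynomial ℂ) (w : ℂ) :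
    Tendsto (fun r : ℝ => p.eval (r * w) / (r : ℂ) ^ p.natDegree) atTop
      (𝓝 (p.leadingCoeff * w ^ p.natDegree)) := by
  have h1 : ∀ r : ℝ, p.eval (r * w) / (r : ℂ) ^ p.natDegree =
      ∑ k ∈ Finset.range (p.natDegree + 1),
        p.coeff k * w ^ k * (((r ^ k / r ^ p.natDegree : ℝ)) : ℂ) := fun r => by
    rw [Polynomial.eval_eq_sum_range, Finset.sum_div]
    refine Finset.sum_congr rfl fun k _ => ?_
    push_cast
    ring
  simp only [h1]
  have h2 : p.leadingCoeff * w ^ p.natDegree = ∑ k ∈ Finset.range (p.natDegree + 1),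
      p.coeff k * w ^ k * (((if k = p.natDegree then 1 else 0 : ℝ)) : ℂ) := by
    rw [Finset.sum_eq_single_of_mem p.natDegree (by simp)]
    · simp
    · intro k _ hk
      simp [hk]
  rw [h2]
  refine tendsto_finsetSum _ fun k hk => ?_
  refine Tendsto.const_mul _ ((Complex.continuous_ofReal.tendsto _).comp ?_)
  by_cases hkn : k = p.natDegree
  · simp only [hkn, if_true]
    refine tendsto_const_nhds.congr' ?_
    filter_upwards [eventually_gt_atTop 0] with r hr
    rw [div_self (by positivity)]
  · simp only [hkn, if_false]
    refine tendsto_pow_div_pow_atTop_zero ?_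
    have := Finset.mem_range.1 hk
    omega

/-- If one root is `±i`, a primitive `n`-th root of unity rotates it off the imaginary axis, as `n ≥
3`. -/
lemma exists_pow_eq_and_sq_ne {n : ℕ} (hn : 3 ≤ n) (a : ℂ) :
    ∃ w : ℂ, w ^ n = a ∧ w ^ 2 ≠ -1 := by
  obtain ⟨w, hw⟩ := IsAlgClosed.exists_pow_nat_eq a (show 0 < n by omega)
  by_cases h : w ^ 2 = -1
  · have hζ := Complex.isPrimitiveRoot_exp n (by omega)
    refine ⟨w * Complex.exp (2 * Real.pi * Complex.I / n), ?_, ?_⟩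
    · rw [mul_pow, hw, hζ.pow_eq_one, mul_one]
    · rw [mul_pow, h]
      intro h2
      have h3 := hζ.pow_ne_one_of_pos_of_lt (l := 2) two_ne_zero (by omega)
      exact h3 (by linear_combination -h2)
  · exact ⟨w, hw, h⟩

/-- A polynomial with the ridge property has degree at most two. -/
theorem natDegree_le_two_of_ridge {p : Polynomial ℂ}
    (hp : ∀ w : ℂ, (p.eval w).re ≤ (p.eval (w.im * Complex.I)).re) : p.natDegree ≤ 2 := by
  by_contra! hn
  set n := p.natDegree
  set c := p.leadingCoeff
  have hc : c ≠ 0 := by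
    rw [Polynomial.leadingCoeff_ne_zero]
    rintro rfl
    simp [n] at hn
  have hlead : ∀ w : ℂ, (c * w ^ n).re ≤ (c * (w.im * Complex.I) ^ n).re := by
    intro w
    refine le_of_tendsto_of_tendsto
      ((Complex.continuous_re.tendsto _).comp (tendsto_eval_mul_div_pow p w))
      ((Complex.continuous_re.tendsto _).comp (tendsto_eval_mul_div_pow p (w.im * Complex.I))) ?_
    filter_upwards [eventually_gt_atTop 0] with r hr
    have h1 := hp (r * w)
    rw [Complex.im_ofReal_mul, Complex.ofReal_mul, mul_assoc] at h1
    simp only [Function.comp_apply, ← Complex.ofReal_pow, Complex.div_ofReal_re]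
    gcongr
  have hcn : (0 : ℝ) < ‖c‖ := norm_pos_iff.2 hc
  -- On the unit circle `w` maximizes the real part of the leading term, with `|w.im| < 1`, whereas
  -- the ridge property bounds that maximum `‖c‖` by `‖c‖ |w.im| ^ n`.
  obtain ⟨w, hw, hw2⟩ := exists_pow_eq_and_sq_ne hn ((‖c‖ : ℂ) / c)
  have hnorm : ‖w‖ = 1 := by
    have h1 : ‖w‖ ^ n = 1 := by
      rw [← norm_pow, hw, norm_div, Complex.norm_real, norm_norm, div_self hcn.ne']
    exact (pow_eq_one_iff_of_nonneg (norm_nonneg _) (by omega)).1 h1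
  have him : |w.im| < 1 := by
    refine lt_of_le_of_ne (hnorm ▸ Complex.abs_im_le_norm w) fun h => hw2 ?_
    have h1 : w.im ^ 2 = 1 := by rw [← sq_abs, h, one_pow]
    have h2 : w.re * w.re + w.im * w.im = 1 := by
      rw [← Complex.normSq_apply, Complex.normSq_eq_norm_sq, hnorm, one_pow]
    have h3 : w.re = 0 := by nlinarith
    apply Complex.ext <;> simp [sq, h3]
    nlinarith
  have h1 := hlead w
  rw [hw, mul_div_cancel₀ _ hc, Complex.ofReal_re] at h1
  have h2 : (c * (w.im * Complex.I) ^ n).re ≤ ‖c‖ * |w.im| ^ n := by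
    refine (Complex.re_le_norm _).trans_eq ?_
    simp
  have h3 : |w.im| ^ n < 1 := pow_lt_one₀ (abs_nonneg _) him (by omega)
  nlinarith

/-- **Marcinkiewicz's theorem**: if a characteristic function is the exponential of a polynomial,
the distribution is Gaussian. -/
theorem exists_eq_gaussianReal_of_charFun_eq_exp {p : Polynomial ℂ} (hp0 : p.eval 0 = 0)
    (hμ : ∀ t : ℝ, charFun μ t = Complex.exp (p.eval (t : ℂ))) :
    ∃ (m : ℝ) (v : NNReal), μ = gaussianReal m v := by
  have hridge : ∀ w : ℂ, (p.eval w).re ≤ (p.eval (w.im * Complex.I)).re := fun w => by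
    have := norm_le_of_charFun_entire (G := fun z => Complex.exp (p.eval z)) (by fun_prop) hμ w
    simpa [Complex.norm_exp] using this
  have hdeg := natDegree_le_two_of_ridge hridge
  have hc0 : p.coeff 0 = 0 := by rw [Polynomial.coeff_zero_eq_eval_zero, hp0]
  have heval : ∀ z : ℂ, p.eval z = p.coeff 1 * z + p.coeff 2 * z ^ 2 := fun z => by
    rw [Polynomial.eval_eq_sum_range' (show p.natDegree < 3 by omega)]
    simp [Finset.sum_range_succ, hc0]
  set a := p.coeff 1
  set b := p.coeff 2
  have key : ∀ x y : ℝ, b.re * x ^ 2 - 2 * b.im * x * y + a.re * x ≤ 0 := fun x y => by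
    have h1 := hridge (x + y * Complex.I)
    simp only [heval] at h1
    simp [sq] at h1
    nlinarith
  have hbim : b.im = 0 := by
    by_contra hb
    -- This `y` makes the left side of `key` equal to 1.
    have h1 := key 1 ((b.re + a.re - 1) / (2 * b.im))
    have h2 : 2 * b.im * 1 * ((b.re + a.re - 1) / (2 * b.im)) = b.re + a.re - 1 := by
      field_simp
    rw [h2] at h1
    linarith
  have hare : a.re = 0 := by
    by_contra ha
    have h1 := key (a.re / (|b.re| + 1)) 0
    have h2 : b.re * (a.re / (|b.re| + 1)) ^ 2 - 2 * b.im * (a.re / (|b.re| + 1)) * 0 +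
        a.re * (a.re / (|b.re| + 1)) = a.re ^ 2 * (b.re + |b.re| + 1) / (|b.re| + 1) ^ 2 := by
      field_simp
      ring
    have h3 : 0 < b.re + |b.re| + 1 := by linarith [neg_abs_le b.re]
    have h4 : 0 < a.re ^ 2 * (b.re + |b.re| + 1) / (|b.re| + 1) ^ 2 := by positivity
    linarith
  have hbre : b.re ≤ 0 := by
    have := key 1 0
    simpa [hare] using this
  refine ⟨a.im, (-2 * b.re).toNNReal, Measure.ext_of_charFun ?_⟩
  ext t
  rw [hμ, charFun_gaussianReal, heval, Real.coe_toNNReal _ (by linarith)]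
  congr 1
  apply Complex.ext <;> simp [sq, hbim, hare] <;> ring

end Marcinkiewicz

/-! ### Lists related entrywise -/

section ListLemmas

variable {α β : Type*}

lemma List.Forall₂.exists_mem_of_mem_right {r : α → β → Prop} {l : List α} {l' : List β}
    (h : List.Forall₂ r l l') {b : β} (hb : b ∈ l') : ∃ a ∈ l, r a b := by
  induction h with
  | nil => simp at hb
  | cons hr _ ih =>
    rcases List.mem_cons.1 hb with rfl | hb
    · exact ⟨_, List.mem_cons_self, hr⟩
    · obtain ⟨a, ha, hab⟩ := ih hb
      exact ⟨a, List.mem_cons_of_mem _ ha, hab⟩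

lemma exists_list_of_forall₂_mem_image {γ : Type*} (T : α → β) (c : γ → Set α) {L' : List β}
    {Us : List γ} (h : List.Forall₂ (· ∈ ·) L' (Us.map fun U => T '' c U)) :
    ∃ L, List.Forall₂ (fun a U => a ∈ c U) L Us ∧ L' = L.map T := by
  induction Us generalizing L' with
  | nil =>
    obtain rfl := List.forall₂_nil_right_iff.1 h
    exact ⟨[], .nil, rfl⟩
  | cons U Us ih =>
    obtain ⟨_, L', ⟨a, ha, rfl⟩, hL', rfl⟩ := List.forall₂_cons_right_iff.1 h
    obtain ⟨L, hL, rfl⟩ := ih hL'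
    exact ⟨a :: L, .cons ha hL, rfl⟩

end ListLemmas

/-! ### Adjoints of the operator columns -/

section Columns

variable {X : Type*} [NormedAddCommGroup X] [NormedSpace ℝ X] {m n : ℕ}

/-- The `i`-th column of operators as an operator `X → Xᵐ`. -/
noncomputable def columnMap (A : Fin m → Fin n → X →L[ℝ] X) (i : Fin n) : X →L[ℝ] (Fin m → X) :=
  ContinuousLinearMap.pi fun p => A p i

/-- The adjoint of the `i`-th column: `f ↦ ∑ₚ fₚ ∘ A_{pi}`. -/
noncomputable def columnAdjoint (A : Fin m → Fin n → X →L[ℝ] X) (i : Fin n) :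
    (Fin m → StrongDual ℝ X) →ₗ[ℝ] StrongDual ℝ X where
  toFun f := (tupleDual f).comp (columnMap A i)
  map_add' f g := by
    ext x
    simp [tupleDual, Finset.sum_add_distrib]
  map_smul' c f := by
    ext x
    simp [tupleDual, Finset.mul_sum]

lemma columnAdjoint_apply (A : Fin m → Fin n → X →L[ℝ] X) (i : Fin n)
    (f : Fin m → StrongDual ℝ X) (x : X) : columnAdjoint A i f x = ∑ p, f p (A p i x) := by
  simp [columnAdjoint, tupleDual, columnMap]

lemma columnAdjoint_single (A : Fin m → Fin n → X →L[ℝ] X) (i : Fin n) (p : Fin m)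
    (f : StrongDual ℝ X) (x : X) : columnAdjoint A i (Pi.single p f) x = f (A p i x) := by
  rw [columnAdjoint_apply, Finset.sum_eq_single_of_mem p (Finset.mem_univ p)]
  · simp
  · intro q _ hq
    simp [Pi.single_eq_of_ne hq]

lemma exists_tupleDual_eq (g : StrongDual ℝ (Fin m → X)) : ∃ f, tupleDual f = g := by
  refine ⟨fun p => g.comp (ContinuousLinearMap.single ℝ (fun _ => X) p), ?_⟩
  ext x
  simp only [tupleDual, sum_apply, ContinuousLinearMap.comp_apply,
    ContinuousLinearMap.proj_apply, ContinuousLinearMap.single_apply]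
  rw [← map_sum, Finset.univ_sum_single]

/-- The image is the range of the adjoint of `A p i`, which annihilates only the kernel of `A p i`.
-/
lemma total_map_range_single (A : Fin m → Fin n → X →L[ℝ] X) (i : Fin n) (p : Fin m)
    (hker : LinearMap.ker (A p i : X →ₗ[ℝ] X) = ⊥) (x : X)
    (hx : ∀ v ∈ (LinearMap.range (LinearMap.single ℝ (fun _ : Fin m => StrongDual ℝ X) p)).map
      (columnAdjoint A i), v x = 0) : x = 0 := by
  refine LinearMap.ker_eq_bot'.1 hker x ?_
  refine SeparatingDual.eq_zero_of_forall_dual_eq_zero (R := ℝ) fun f => ?_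
  refine (columnAdjoint_single A i p f x).symm.trans ?_
  exact hx _ ⟨_, ⟨f, rfl⟩, rfl⟩

/-- By Hahn–Banach, a point of `Gᵢ` killed by every functional vanishing on `Gⱼ` lies in the closure
of `Gⱼ`, hence is zero. -/
lemma total_map_ker (A : Fin m → Fin n → X →L[ℝ] X) {i j : Fin n} (p : Fin m)
    (hker : LinearMap.ker (A p i : X →ₗ[ℝ] X) = ⊥)
    (hG : closure (columnRange A i) ∩ closure (columnRange A j) = {0}) (x : X)
    (hx : ∀ v ∈ (LinearMap.ker (columnAdjoint A j)).map (columnAdjoint A i), v x = 0) :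
    x = 0 := by
  have hrange : columnRange A j =
      (LinearMap.range (columnMap A j : X →ₗ[ℝ] (Fin m → X)) : Set (Fin m → X)) := rfl
  have hmem : columnMap A i x ∈ closure (columnRange A j) := by
    by_contra hnot
    obtain ⟨g, u, hgx, hg⟩ := geometric_hahn_banach_point_closed
      (hrange ▸ (LinearMap.range (columnMap A j : X →ₗ[ℝ] (Fin m → X))).convex).closure
      isClosed_closure hnot
    have hmul : ∀ y (c : ℝ), u < c * g (columnMap A j y) := fun y c => by
      have := hg _ (subset_closure (show columnMap A j (c • y) ∈ columnRange A j from ⟨c • y, rfl⟩))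
      simpa using this
    -- A functional bounded below on a subspace vanishes there.
    have hzero : ∀ y, g (columnMap A j y) = 0 := fun y => by
      by_contra hy
      have := hmul y (u / g (columnMap A j y))
      rw [div_mul_cancel₀ _ hy] at this
      exact lt_irrefl _ this
    have hu : u < 0 := by simpa using hmul 0 0
    obtain ⟨f, rfl⟩ := exists_tupleDual_eq g
    have h1 : columnAdjoint A j f = 0 := ContinuousLinearMap.ext hzero
    have h2 : tupleDual f (columnMap A i x) = 0 := hx _ ⟨f, h1, rfl⟩
    linarith
  have h0 : columnMap A i x ∈ ({0} : Set (Fin m → X)) := hG ▸ ⟨subset_closure ⟨x, rfl⟩, hmem⟩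
  exact LinearMap.ker_eq_bot'.1 hker x (congrFun h0 p)

end Columns

/-! ### Elimination in the functional equation -/

section FunctionalEquation

variable {X : Type*} [NormedAddCommGroup X] [NormedSpace ℝ X] {m n : ℕ}
  {G : Type*} [AddCommGroup G]

/-- The list of subspaces of `(X*)ᵐ` whose differences eliminate every function of fewer than `m`
of the variables, and every column but the `i`-th. -/
noncomputable def eliminationSubspaces (A : Fin m → Fin n → X →L[ℝ] X) (i : Fin n) :
    List (Submodule ℝ (Fin m → StrongDual ℝ X)) :=
  (List.finRange m).map
      (fun p => LinearMap.range (LinearMap.single ℝ (fun _ : Fin m => StrongDual ℝ X) p)) ++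
    ((List.finRange n).filter (· ≠ i)).map fun j => LinearMap.ker (columnAdjoint A j)

lemma diffList_eq_zero_of_functional_equation (A : Fin m → Fin n → X →L[ℝ] X)
    (Φ : Fin n → StrongDual ℝ X → G) (𝒮 : Finset (Finset (Fin m))) (h𝒮 : ∀ S ∈ 𝒮, ∃ p, p ∉ S)
    (ρ : (S : Finset (Fin m)) → (S → StrongDual ℝ X) → G)
    (heq : ∀ f : Fin m → StrongDual ℝ X,
      ∑ i, Φ i (columnAdjoint A i f) = ∑ S ∈ 𝒮, ρ S fun p => f p)
    (i : Fin n) {L : List (Fin m → StrongDual ℝ X)}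
    (hL : List.Forall₂ (fun a (U : Submodule ℝ (Fin m → StrongDual ℝ X)) =>
      a ∈ (U : Set (Fin m → StrongDual ℝ X))) L (eliminationSubspaces A i))
    (f : Fin m → StrongDual ℝ X) :
    diffList (L.map (columnAdjoint A i)) (Φ i) (columnAdjoint A i f) = 0 := by
  classical
  have hρ : ∀ S ∈ 𝒮, diffList L (fun f : Fin m → StrongDual ℝ X => ρ S fun p => f p) = 0 := by
    intro S hS
    obtain ⟨p, hp⟩ := h𝒮 S hS
    obtain ⟨_, hmem, ⟨g, rfl⟩⟩ := hL.exists_mem_of_mem_right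
      (List.mem_append_left _ (List.mem_map_of_mem (List.mem_finRange p)))
    refine diffList_eq_zero_of_mem hmem ?_
    ext f
    rw [fwdDiff, Pi.zero_apply, sub_eq_zero]
    congr 1
    ext q
    have hqp : (q : Fin m) ≠ p := fun h => hp (h ▸ q.2)
    simp [Pi.single_eq_of_ne hqp]
  have hΦ : ∀ j ≠ i, diffList L (Φ j ∘ (columnAdjoint A j).toAddMonoidHom) = 0 := by
    intro j hj
    obtain ⟨k, hmem, hk⟩ := hL.exists_mem_of_mem_right
      (List.mem_append_right _ (List.mem_map_of_mem
        (List.mem_filter.2 ⟨List.mem_finRange j, by simpa using hj⟩)))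
    refine diffList_eq_zero_of_mem hmem ?_
    have hk' : columnAdjoint A j k = 0 := hk
    ext f
    simp [fwdDiff, hk']
  have hsum : ∑ j, Φ j ∘ (columnAdjoint A j).toAddMonoidHom =
      ∑ S ∈ 𝒮, fun f : Fin m → StrongDual ℝ X => ρ S fun p => f p := by
    ext f
    simpa using heq f
  have h1 := congrArg (diffList L) hsum
  rw [diffList_finsetSum, diffList_finsetSum, Finset.sum_eq_zero hρ,
    Finset.sum_eq_single_of_mem i (Finset.mem_univ i) fun j _ hj => hΦ j hj, diffList_comp] at h1
  exact congrFun h1 f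

variable [CompleteSpace X] [TopologicalSpace.SeparableSpace X] [TopologicalSpace G]
  [IsTopologicalAddGroup G] [T2Space G]

theorem fwdDiff_iterate_eq_zero_of_functional_equation (hX : IsQuasireflexive X) (hm : 0 < m)
    (A : Fin m → Fin n → X →L[ℝ] X)
    (hker : ∀ p i, LinearMap.ker (A p i : X →ₗ[ℝ] X) = ⊥)
    (hG : ∀ i j, i ≠ j → closure (columnRange A i) ∩ closure (columnRange A j) = {0})
    (Φ : Fin n → StrongDual ℝ X → G) (hΦ : ∀ i, IsWeakStarSeqContinuous (Φ i))
    (𝒮 : Finset (Finset (Fin m))) (h𝒮 : ∀ S ∈ 𝒮, ∃ p, p ∉ S)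
    (ρ : (S : Finset (Fin m)) → (S → StrongDual ℝ X) → G)
    (heq : ∀ f : Fin m → StrongDual ℝ X,
      ∑ i, Φ i (columnAdjoint A i f) = ∑ S ∈ 𝒮, ρ S fun p => f p) (i : Fin n) :
    ∃ N, 0 < N ∧ ∀ h u, (fwdDiff h)^[N] (Φ i) u = 0 := by
  set p₀ : Fin m := ⟨0, hm⟩
  refine ⟨(eliminationSubspaces A i).length, by simp [eliminationSubspaces, hm], fun h u => ?_⟩
  rw [← diffList_replicate]
  refine diffList_eq_zero_of_dense ((eliminationSubspaces A i).map
    fun U : Submodule ℝ (Fin m → StrongDual ℝ X) => columnAdjoint A i '' (U : Set (Fin m → StrongDual ℝ X))) ?_ (hΦ i) ?_ _ (by simp) u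
  · intro S hS
    obtain ⟨U, hU, rfl⟩ := List.mem_map.1 hS
    rw [← Submodule.map_coe]
    refine isWeakStarSeqDense_of_total hX _ ?_
    rcases List.mem_append.1 hU with hU | hU
    · obtain ⟨p, -, rfl⟩ := List.mem_map.1 hU
      exact total_map_range_single A i p (hker p i)
    · obtain ⟨j, hj, rfl⟩ := List.mem_map.1 hU
      have hji : j ≠ i := by simpa using hj
      exact total_map_ker A p₀ (hker p₀ i) (hG i j hji.symm)
  · intro L' hL'
    obtain ⟨L, hL, rfl⟩ := exists_list_of_forall₂_mem_image (columnAdjoint A i)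
      (fun U : Submodule ℝ (Fin m → StrongDual ℝ X) => (U : Set (Fin m → StrongDual ℝ X))) hL'
    -- Elimination gives vanishing only at base points in the range of `columnAdjoint A i`; this
    -- contains a dense subspace, and continuity does the rest.
    refine ((hΦ i).diffList _).eq_zero_of_dense
      (isWeakStarSeqDense_of_total hX _ (total_map_range_single A i p₀ (hker p₀ i))) ?_
    rintro _ ⟨f, -, rfl⟩
    exact diffList_eq_zero_of_functional_equation A Φ 𝒮 h𝒮 ρ heq i hL f

end FunctionalEquation

/-! ### Characteristic functionals -/

section CharacteristicFunctionals

variable {X : Type*} [NormedAddCommGroup X] [NormedSpace ℝ X] [MeasurableSpace X] [BorelSpace X]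

/-- Dominated convergence, the integrands having modulus 1. -/
lemma tendsto_charFunDual_of_tendsto_apply (μ : Measure X) [IsProbabilityMeasure μ]
    (v : ℕ → StrongDual ℝ X) (f : StrongDual ℝ X)
    (hv : ∀ x, Tendsto (fun n => v n x) atTop (𝓝 (f x))) :
    Tendsto (fun n => charFunDual μ (v n)) atTop (𝓝 (charFunDual μ f)) := by
  simp only [charFunDual_apply]
  refine tendsto_integral_of_dominated_convergence (fun _ => 1) (fun n => ?_)
    (integrable_const _) (fun n => ae_of_all _ fun x => ?_) (ae_of_all _ fun x => ?_)
  · exact Measurable.aestronglyMeasurable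
      (Complex.measurable_exp.comp
        ((Complex.measurable_ofReal.comp (v n).continuous.measurable).mul_const _))
  · rw [Complex.norm_exp_ofReal_mul_I]
  · exact ((Complex.continuous_exp.comp (by fun_prop :
      Continuous fun t : ℝ => (t : ℂ) * Complex.I)).tendsto (f x)).comp (hv x)

lemma tendsto_ofMul_mk0 {ι : Type*} {l : Filter ι} {g : ι → ℂ} {a : ℂ} (hg : ∀ i, g i ≠ 0)
    (ha : a ≠ 0) (h : Tendsto g l (𝓝 a)) :
    Tendsto (fun i => Additive.ofMul (Units.mk0 (g i) (hg i))) l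
      (𝓝 (Additive.ofMul (Units.mk0 a ha))) := by
  refine (continuous_ofMul.tendsto _).comp ?_
  rw [Units.isEmbedding_val₀.tendsto_nhds_iff]
  exact h

/-- A distribution on a Banach space is Gaussian when its nonvanishing characteristic functional
has trivial multiplicative differences of some order. -/
theorem isGaussian_of_fwdDiff_iterate_eq_zero (μ : Measure X) [IsProbabilityMeasure μ]
    (hne : ∀ f, charFunDual μ f ≠ 0) {N : ℕ} (hN0 : 0 < N)
    (hN : ∀ h u, (fwdDiff h)^[N]
      (fun f => Additive.ofMul (Units.mk0 (charFunDual μ f) (hne f))) u = 0) :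
    IsGaussian μ := by
  refine isGaussian_of_map_eq_gaussianReal fun f => ?_
  have : IsProbabilityMeasure (μ.map f) := Measure.isProbabilityMeasure_map (by fun_prop)
  have hchar : ∀ t, charFun (μ.map f) t = charFunDual μ (t • f) :=
    charFun_map_eq_charFunDual_smul f
  have hne' : ∀ t, charFun (μ.map f) t ≠ 0 := fun t => by rw [hchar]; exact hne _
  obtain ⟨p, hp0, hp⟩ := exists_eq_exp_polynomial (continuous_charFun (μ := μ.map f)) (by simp)
    hne' hN0 (fun h t => by
      have h1 : (fun s => Additive.ofMul (Units.mk0 (charFun (μ.map f) s) (hne' s))) =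
          (fun f => Additive.ofMul (Units.mk0 (charFunDual μ f) (hne f))) ∘
            ((smulAddHom ℝ (StrongDual ℝ X)).flip f) := by
        ext s
        simp [hchar]
      rw [h1, ← diffList_replicate, diffList_comp, List.map_replicate, diffList_replicate]
      exact hN _ _)
  exact exists_eq_gaussianReal_of_charFun_eq_exp hp0 hp

lemma charFunDual_map_columns [TopologicalSpace.SeparableSpace X] {Ω : Type*} [MeasurableSpace Ω]
    (P : Measure Ω) [IsProbabilityMeasure P] {m n : ℕ} (A : Fin m → Fin n → X →L[ℝ] X)
    (ξ : Fin n → Ω → X) (hξ : ∀ i, Measurable (ξ i)) (hindep : iIndepFun ξ P)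
    (f : Fin m → StrongDual ℝ X) :
    charFunDual (P.map (fun ω (p : Fin m) => ∑ i, A p i (ξ i ω))) (tupleDual f) =
      ∏ i, charFunDual (P.map (ξ i)) (columnAdjoint A i f) := by
  have : SecondCountableTopology X := UniformSpace.secondCountable_of_separable X
  have hmeas : ∀ i, Measurable fun ω => columnMap A i (ξ i ω) := fun i =>
    (columnMap A i).continuous.measurable.comp (hξ i)
  have h1 : (fun ω (p : Fin m) => ∑ i, A p i (ξ i ω)) = fun ω => ∑ i, columnMap A i (ξ i ω) := by
    ext ω p
    simp [columnMap]
  have h2 : iIndepFun (fun i ω => columnMap A i (ξ i ω)) P :=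
    hindep.comp (fun i => columnMap A i) fun i => (columnMap A i).continuous.measurable
  rw [h1, h2.charFunDual_map_fun_sum_eq_prod fun i => (hmeas i).aemeasurable, Finset.prod_apply]
  refine Finset.prod_congr rfl fun i _ => ?_
  have h3 : P.map (fun ω => columnMap A i (ξ i ω)) = (P.map (ξ i)).map (columnMap A i) :=
    (Measure.map_map (columnMap A i).continuous.measurable (hξ i)).symm
  rw [h3, charFunDual_map]
  rfl

end CharacteristicFunctionals

/-! ### The characterization theorem -/

theorem theorem2p4 {X : Type*} [NormedAddCommGroup X] [NormedSpace ℝ X] [CompleteSpace X]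
    [TopologicalSpace.SeparableSpace X] [MeasurableSpace X] [BorelSpace X]
    (hX : IsQuasireflexive X)
    {Ω : Type*} [MeasurableSpace Ω] (P : Measure Ω) [IsProbabilityMeasure P]
    (m n : ℕ) (hm : 2 ≤ m)
    (A : Fin m → Fin n → X →L[ℝ] X)
    (hker : ∀ p i, LinearMap.ker (A p i : X →ₗ[ℝ] X) = ⊥)
    (hG : ∀ i j, i ≠ j → closure (columnRange A i) ∩ closure (columnRange A j) = {0})
    (ξ : Fin n → Ω → X) (hξ : ∀ i, Measurable (ξ i))
    (hindep : iIndepFun ξ P)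
    (hchar : ∀ i, ∀ f : StrongDual ℝ X, charFunDual (P.map (ξ i)) f ≠ 0)
    (hL : KaganClass m (m - 1) (P.map (fun ω (p : Fin m) => ∑ i, A p i (ξ i ω)))) :
    ∀ i, HasGaussianLaw (ξ i) P := by
  classical
  intro i
  obtain ⟨R, -, hR⟩ := hL
  have hprob : ∀ i, IsProbabilityMeasure (P.map (ξ i)) := fun i =>
    Measure.isProbabilityMeasure_map (hξ i).aemeasurable
  have hprod : ∀ f, ∏ i, charFunDual (P.map (ξ i)) (columnAdjoint A i f) =
      ∏ S ∈ Finset.powersetCard (m - 1) Finset.univ, R S fun p => f p := fun f => by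
    rw [← charFunDual_map_columns P A ξ hξ hindep, hR]
  -- Extending `x` by zero makes `R S x` a factor of a nonzero product.
  have hRne : ∀ S : Finset (Fin m), S.card = m - 1 → ∀ x, R S x ≠ 0 := by
    intro S hS x
    have h1 := hprod fun p => if hp : p ∈ S then x ⟨p, hp⟩ else 0
    have h2 := h1 ▸ Finset.prod_ne_zero_iff.2 fun i _ => hchar i _
    have h3 := Finset.prod_ne_zero_iff.1 h2 S (Finset.mem_powersetCard.2 ⟨Finset.subset_univ _, hS⟩)
    convert h3 with p
    simp
  let Φ : Fin n → StrongDual ℝ X → Additive ℂˣ := fun i f =>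
    Additive.ofMul (Units.mk0 (charFunDual (P.map (ξ i)) f) (hchar i f))
  -- The value 0 for other cardinalities is a dummy: such `S` do not occur in the product.
  let ρ : (S : Finset (Fin m)) → (S → StrongDual ℝ X) → Additive ℂˣ := fun S x =>
    if hS : S.card = m - 1 then Additive.ofMul (Units.mk0 (R S x) (hRne S hS x)) else 0
  have heq : ∀ f : Fin m → StrongDual ℝ X, ∑ i, Φ i (columnAdjoint A i f) =
      ∑ S ∈ Finset.powersetCard (m - 1) Finset.univ, ρ S fun p => f p := fun f => by
    apply Additive.toMul.injective
    rw [toMul_sum, toMul_sum]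
    ext
    rw [Units.coe_prod, Units.coe_prod]
    refine Eq.trans ?_ ((hprod f).trans (Finset.prod_congr rfl fun S hS => ?_))
    · rfl
    · simp only [ρ, dif_pos (Finset.mem_powersetCard.1 hS).2]
      rfl
  have : T2Space (Additive ℂˣ) :=
    inferInstanceAs (T2Space ℂˣ)
  obtain ⟨N, hN0, hN⟩ := fwdDiff_iterate_eq_zero_of_functional_equation hX (by omega) A hker hG Φ
    (fun i v f hv => tendsto_ofMul_mk0 (fun n => hchar i (v n)) (hchar i f)
      (tendsto_charFunDual_of_tendsto_apply (P.map (ξ i)) v f hv))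
    (Finset.powersetCard (m - 1) Finset.univ)
    (fun S hS => by
      by_contra! h
      have h1 : S = Finset.univ := Finset.eq_univ_iff_forall.2 h
      have h2 := (Finset.mem_powersetCard.1 hS).2
      rw [h1, Finset.card_univ, Fintype.card_fin] at h2
      omega)
    ρ heq i
  exact ⟨isGaussian_of_fwdDiff_iterate_eq_zero (P.map (ξ i)) (hchar i) hN0 hN⟩
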